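/- For $t\in[0,1]$ and $x>0$ let $f_t(x)=\frac{x-1}{t(x-1)+1}$. Let $\nu$ be a probability measure on $[0,1]$ and let $g:(0,\infty)\to\mathbb{R}$ be a function, differentiable at $1$ with $g'(1)\ge 0$, such that $$g(x)=g(1)+g'(1)\int_0^1 f_t(x)\,d\nu(t)\qquad\text{for all }x>0.$$ Let $t_1,\dots,t_m\in[0,1]$ and $w_1,\dots,w_m>0$ be the nodes and weights of an $m$-point Gaussian quadrature for $\nu$, i.e. $\int_0^1 p\,d\nu=\sum_{i=1}^m w_i\,p(t_i)$ for every real polynomial $p$ of degree at most $2m-1$ (the nodes may coincide), and put $$r_m(x)=g(1)+g'(1)\sum_{i=1}^m w_i f_{t_i}(x).$$ Then the following hold. 1. If $m\ge 1$ and $x>0$, then $$|g(x)-r_m(x)|\le 4g'(1)\left|\sqrt x-\tfrac1{\sqrt x}\right|\frac{\rho^{2m}}{1-\rho},\qquad \rho=\left|\frac{\sqrt x-1}{\sqrt x+1}\right|.$$ 2. If $\nu$ is invariant under $t\mapsto 1-t$, then for all $m\ge1$ and $x>0$, with the same $\rho$, $$|g(x)-r_m(x)|\le g'(1)\left|\sqrt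 x-\tfrac1{\sqrt x}\right|^{2}\rho^{2m-1}.$$ If $g'(1)\neq 0$, then $\nu$ is invariant under $t\mapsto 1-t$ if and only if $g(x^{-1})-g(1)=-(g(x)-g(1))$ for all $x>0$. 3. $r_m(x)\ge g(x)$ for all $0<x\le 1$, and $r_m(x)\le g(x)$ for all $x\ge 1$. -/

import Mathlib

open MeasureTheory Polynomial

noncomputable section

/-- The rational function `f_t(x) = (x - 1) / (t (x - 1) + 1)`.
For `t ∈ [0,1]` and `x > 0` the denominator is positive. -/
def loewnerKernel (t x : ℝ) : ℝ := (x - 1) / (t * (x - 1) + 1)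

/-- `g : (0, ∞) → ℝ` (a function on `ℝ` of which only the values on `(0, ∞)` are used) has the
integral representation `g(x) = g(1) + g'(1) ∫₀¹ f_t(x) dν(t)` for all `x > 0`. -/
structure HasLoewnerRep (g : ℝ → ℝ) (ν : Measure ℝ) : Prop where
  differentiableAt_one : DifferentiableAt ℝ g 1
  eq_integral : ∀ x : ℝ, 0 < x →
    g x = g 1 + deriv g 1 * ∫ t in Set.Icc (0 : ℝ) 1, loewnerKernel t x ∂ν

/-- The nodes `t i` and weights `w i`, `i < m`, form an `m`-point Gaussian quadrature on `[0,1]`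
for the measure `ν`: the nodes lie in `[0,1]`, the weights are positive, and the rule integrates
every polynomial of degree at most `2 m - 1` exactly.
Nodes may coincide; for a `ν` whose support has at least `m` points they are automatically
distinct, and a `ν` with a smaller support has such a rule only if coincidences are allowed. -/
structure IsGaussianQuadrature (ν : Measure ℝ) (m : ℕ) (t w : Fin m → ℝ) : Prop where
  node_mem : ∀ i, t i ∈ Set.Icc (0 : ℝ) 1
  weight_pos : ∀ i, 0 < w i
  exact_of_natDegree_lt : ∀ p : ℝ[X], p.natDegree < 2 * m →
    ∫ s in Set.Icc (0 : ℝ) 1, p.eval s ∂ν = ∑ i, w i * p.eval (t i)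

/-- The rational approximant `r_m(x) = g(1) + g'(1) ∑ᵢ wᵢ f_{tᵢ}(x)`. -/
def quadratureApprox (g : ℝ → ℝ) {m : ℕ} (t w : Fin m → ℝ) (x : ℝ) : ℝ :=
  g 1 + deriv g 1 * ∑ i, w i * loewnerKernel (t i) x

end

/-! Everything concerns the quadrature error for `s ↦ f_s(x)`, a simple fraction with pole `τ =
-1/(x-1)` outside `[0,1]`. Sign: interpolating at doubled nodes splits the fraction into an exactly
integrated polynomial and `x - 1` times a nonnegative function vanishing at the nodes
(`IsGaussianQuadrature.exists_error_eq`). Size: with `y = √x` and `c = 2s - 1`, the fraction is `y -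
1/y` times a Poisson kernel in `c`, whose best polynomial approximation is explicit in Chebyshev
polynomials (`abs_poisson_sub_chebyshevApprox_le`). Degree `2m - 1` gives the bound with `ρ^(2m-1)`,
and `sq_mul_pow_le` passes to the one with `ρ^(2m)`. Symmetry: `f_s(1/x) = -f_{1-s}(x)`, and the
transform determines `ν` through its moments. -/

/-- The node polynomial `∏ i, (X - t i)`, squared, interpolates `s ↦ 1 / (s - τ)` with the
polynomial remainder `(π(τ)² - π²) / (X - τ)`, of degree less than `2 m`. -/
theorem exists_hermite_interpolant {m : ℕ} (hm : 1 ≤ m) (t : Fin m → ℝ) (τ : ℝ) :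
    ∃ p : ℝ[X], p.natDegree < 2 * m ∧ ∀ s : ℝ,
      (s - τ) * p.eval s = (∏ i, (τ - t i)) ^ 2 - (∏ i, (s - t i)) ^ 2 := by
  set N : ℝ[X] := ∏ i, (X - C (t i)) with hN
  have hNeval : ∀ s, N.eval s = ∏ i, (s - t i) := fun s => by
    simp [hN, eval_prod]
  have hNdeg : N.natDegree = m := by
    rw [hN, natDegree_prod_of_monic _ _ (fun i _ => monic_X_sub_C _)]
    simp
  set Q : ℝ[X] := C ((N.eval τ) ^ 2) - N ^ 2 with hQ
  have hroot : Q.IsRoot τ := by simp [hQ]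
  have hQdeg : Q.natDegree ≤ 2 * m := by
    refine (natDegree_sub_le _ _).trans ?_
    simp [natDegree_pow, hNdeg]
  refine ⟨Q /ₘ (X - C τ), ?_, fun s => ?_⟩
  · rw [natDegree_divByMonic _ (monic_X_sub_C τ), natDegree_X_sub_C]
    omega
  · have h := congrArg (eval s) (mul_divByMonic_eq_iff_isRoot.2 hroot)
    simp only [eval_mul, eval_sub, eval_X, eval_C, hQ, eval_pow] at h
    rw [← hNeval, ← hNeval, ← h]

theorem loewnerKernel_den_pos {s x : ℝ} (hs : s ∈ Set.Icc (0 : ℝ) 1) (hx : 0 < x) :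
    0 < s * (x - 1) + 1 := by
  obtain ⟨h0, h1⟩ := hs
  rcases le_total 1 x with h | h
  · nlinarith
  · nlinarith

theorem continuousOn_loewnerKernel {x : ℝ} (hx : 0 < x) :
    ContinuousOn (fun s => loewnerKernel s x) (Set.Icc 0 1) := by
  unfold loewnerKernel
  exact ContinuousOn.div (by fun_prop) (by fun_prop)
    fun s hs => (loewnerKernel_den_pos hs hx).ne'

theorem loewnerKernel_inv {s x : ℝ} (hs : s ∈ Set.Icc (0 : ℝ) 1) (hx : 0 < x) :
    loewnerKernel s x⁻¹ = -loewnerKernel (1 - s) x := by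
  have h1 := loewnerKernel_den_pos hs (inv_pos.2 hx)
  have hs' : 1 - s ∈ Set.Icc (0 : ℝ) 1 := ⟨by linarith [hs.2], by linarith [hs.1]⟩
  have h2 := loewnerKernel_den_pos hs' hx
  unfold loewnerKernel
  have h3 : s * (x⁻¹ - 1) + 1 = ((1 - s) * (x - 1) + 1) / x := by field_simp; ring
  rw [h3]
  field_simp
  ring

/-! ### Quadrature error: size and sign. -/

section Quadrature

variable {ν : Measure ℝ} {m : ℕ} {t w : Fin m → ℝ}

theorem IsGaussianQuadrature.sum_weight (hq : IsGaussianQuadrature ν m t w) (hm : 1 ≤ m) :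
    ∑ i, w i = ν.real (Set.Icc 0 1) := by
  have h := hq.exact_of_natDegree_lt 1 (by simp; omega)
  simpa using h.symm

/-- A polynomial approximation with uniform error `B` bounds the quadrature error. -/
theorem IsGaussianQuadrature.abs_error_le [IsFiniteMeasure ν] (hq : IsGaussianQuadrature ν m t w) (hm : 1 ≤ m)
    {h : ℝ → ℝ} (hh : ContinuousOn h (Set.Icc 0 1)) {p : ℝ[X]} (hp : p.natDegree < 2 * m)
    {B : ℝ} (hB : ∀ s ∈ Set.Icc (0 : ℝ) 1, |h s - p.eval s| ≤ B) :
    |∫ s in Set.Icc (0 : ℝ) 1, h s ∂ν - ∑ i, w i * h (t i)| ≤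
      2 * B * ν.real (Set.Icc 0 1) := by
  have hih : IntegrableOn h (Set.Icc 0 1) ν := hh.integrableOn_compact isCompact_Icc
  have hip : IntegrableOn (fun s => p.eval s) (Set.Icc 0 1) ν :=
    p.continuous.continuousOn.integrableOn_compact isCompact_Icc
  have e : ∫ s in Set.Icc (0 : ℝ) 1, h s ∂ν - ∑ i, w i * h (t i) =
      ∫ s in Set.Icc (0 : ℝ) 1, (h s - p.eval s) ∂ν -
        ∑ i, w i * (h (t i) - p.eval (t i)) := by
    rw [integral_sub hih hip, hq.exact_of_natDegree_lt p hp]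
    simp only [mul_sub, Finset.sum_sub_distrib]
    ring
  have h1 : |∫ s in Set.Icc (0 : ℝ) 1, (h s - p.eval s) ∂ν| ≤ B * ν.real (Set.Icc 0 1) := by
    have := norm_setIntegral_le_of_norm_le_const (μ := ν) (s := Set.Icc (0 : ℝ) 1)
      (f := fun s => h s - p.eval s) (C := B) (measure_lt_top _ _)
      (fun s hs => by simpa using hB s hs)
    simpa using this
  have h2 : |∑ i, w i * (h (t i) - p.eval (t i))| ≤ B * ν.real (Set.Icc 0 1) := by
    rw [← hq.sum_weight hm, Finset.mul_sum]
    refine (Finset.abs_sum_le_sum_abs _ _).trans (Finset.sum_le_sum fun i _ => ?_)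
    rw [abs_mul, abs_of_pos (hq.weight_pos i), mul_comm]
    exact mul_le_mul_of_nonneg_right (hB _ (hq.node_mem i)) (hq.weight_pos i).le
  rw [e]
  refine (abs_sub _ _).trans ?_
  linarith

/-- The quadrature error of the kernel is `x - 1` times a nonnegative number. -/
theorem IsGaussianQuadrature.exists_error_eq [IsFiniteMeasure ν] (hq : IsGaussianQuadrature ν m t w) {x : ℝ}
    (hx : 0 < x) :
    ∃ c : ℝ, 0 ≤ c ∧ ∫ s in Set.Icc (0 : ℝ) 1, loewnerKernel s x ∂ν -
      ∑ i, w i * loewnerKernel (t i) x = (x - 1) * c := by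
  rcases eq_or_ne x 1 with rfl | hx1
  · exact ⟨0, le_rfl, by simp [loewnerKernel]⟩
  have hz : x - 1 ≠ 0 := sub_ne_zero.2 hx1
  -- No polynomial has degree below `0`, so the empty rule is treated apart; its error is the
  -- integral itself.
  rcases Nat.eq_zero_or_pos m with rfl | hm
  · refine ⟨∫ s in Set.Icc (0 : ℝ) 1, (s * (x - 1) + 1)⁻¹ ∂ν, ?_, ?_⟩
    · exact setIntegral_nonneg measurableSet_Icc
        fun s hs => (inv_pos.2 (loewnerKernel_den_pos hs hx)).le
    · simp [loewnerKernel, div_eq_mul_inv, integral_const_mul]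
  set τ : ℝ := -1 / (x - 1) with hτ
  have hden : ∀ s : ℝ, s * (x - 1) + 1 = (x - 1) * (s - τ) := fun s => by
    rw [hτ]; field_simp; ring
  set K : ℝ := ∏ i, (τ - t i) with hK
  have hK0 : K ≠ 0 := by
    refine Finset.prod_ne_zero_iff.2 fun i _ h => ?_
    have := loewnerKernel_den_pos (hq.node_mem i) hx
    rw [hden, show t i - τ = 0 by linarith] at this
    simp at this
  obtain ⟨p, hp, hps⟩ := exists_hermite_interpolant hm t τ
  have key : ∀ s ∈ Set.Icc (0 : ℝ) 1, loewnerKernel s x =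
      (x - 1) * ((K ^ 2)⁻¹ * ((∏ i, (s - t i)) ^ 2 / (s * (x - 1) + 1))) +
        (K ^ 2)⁻¹ * p.eval s := by
    intro s hs
    have h0 := (loewnerKernel_den_pos hs hx).ne'
    have hsτ : s - τ ≠ 0 := fun h => h0 (by rw [hden, h, mul_zero])
    rw [loewnerKernel, hden s]
    have := hps s
    field_simp
    linarith
  have hcont : ContinuousOn (fun s : ℝ => (∏ i, (s - t i)) ^ 2 / (s * (x - 1) + 1))
      (Set.Icc 0 1) :=
    ContinuousOn.div (by fun_prop) (by fun_prop)
      fun s hs => (loewnerKernel_den_pos hs hx).ne'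
  refine ⟨(K ^ 2)⁻¹ * ∫ s in Set.Icc (0 : ℝ) 1,
    (∏ i, (s - t i)) ^ 2 / (s * (x - 1) + 1) ∂ν, ?_, ?_⟩
  · refine mul_nonneg (by positivity) (setIntegral_nonneg measurableSet_Icc fun s hs => ?_)
    exact div_nonneg (sq_nonneg _) (loewnerKernel_den_pos hs hx).le
  · rw [setIntegral_congr_fun measurableSet_Icc key, integral_add, integral_const_mul,
      integral_const_mul, integral_const_mul, hq.exact_of_natDegree_lt p hp, Finset.mul_sum]
    · have : ∀ i, w i * loewnerKernel (t i) x = (K ^ 2)⁻¹ * (w i * p.eval (t i)) := fun i => by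
        rw [key _ (hq.node_mem i), Finset.prod_eq_zero (Finset.mem_univ i) (sub_self (t i))]
        ring
      simp only [this]
      ring
    · exact ((hcont.integrableOn_compact isCompact_Icc).const_mul _).const_mul _
    · exact (p.continuous.continuousOn.integrableOn_compact isCompact_Icc).const_mul _

end Quadrature

/-! ### Chebyshev approximation of the Poisson kernel. -/

section Chebyshev

open Polynomial.Chebyshev

/-- The Chebyshev approximant of degree `k + 1` of `(1 - q²) / (1 - 2 q X + q²)`. -/
noncomputable def chebyshevApprox (q : ℝ) (k : ℕ) : ℝ[X] :=
  1 + ∑ j ∈ Finset.range k, C (2 * q ^ (j + 1)) * T ℝ ((j : ℤ) + 1) +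
    C (2 * q ^ (k + 1) / (1 - q ^ 2)) * T ℝ ((k : ℤ) + 1)

theorem natDegree_chebyshevApprox_le (q : ℝ) (k : ℕ) :
    (chebyshevApprox q k).natDegree ≤ k + 1 := by
  have hT : ∀ j : ℕ, (T ℝ ((j : ℤ) + 1)).natDegree ≤ j + 1 := fun j => by
    rw [natDegree_T]; omega
  refine natDegree_add_le_of_degree_le (natDegree_add_le_of_degree_le (by simp) ?_) ?_
  · refine natDegree_sum_le_of_forall_le _ _ fun j hj => ?_
    refine (natDegree_C_mul_le _ _).trans ((hT j).trans ?_)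
    have := Finset.mem_range.1 hj
    omega
  · exact (natDegree_C_mul_le _ _).trans (hT k)

/-- The three-term recurrence makes the product telescope, leaving only the boundary terms. -/
theorem chebyshev_poisson_partial_sum (q c : ℝ) (k : ℕ) :
    (1 - 2 * q * c + q ^ 2) *
        (1 + ∑ j ∈ Finset.range k, 2 * q ^ (j + 1) * (T ℝ ((j : ℤ) + 1)).eval c) =
      1 - q ^ 2 - 2 * q ^ (k + 1) * (T ℝ ((k : ℤ) + 1)).eval c +
        2 * q ^ (k + 2) * (T ℝ (k : ℤ)).eval c := by
  induction k with
  | zero => simp; ring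
  | succ k ih =>
    have h : (T ℝ ((k : ℤ) + 2)).eval c =
        2 * c * (T ℝ ((k : ℤ) + 1)).eval c - (T ℝ (k : ℤ)).eval c := by
      simp [T_add_two]
    rw [Finset.sum_range_succ, ← add_assoc, mul_add, ih]
    push_cast
    rw [show (k : ℤ) + 1 + 1 = k + 2 by ring, h]
    ring

theorem abs_chebyshev_combination_le (q : ℝ) {c : ℝ} (hc : c ∈ Set.Icc (-1 : ℝ) 1) (k : ℕ) :
    |2 * (c - q) * (T ℝ ((k : ℤ) + 1)).eval c - (1 - q ^ 2) * (T ℝ (k : ℤ)).eval c| ≤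
      1 - 2 * q * c + q ^ 2 := by
  have hW : 0 ≤ 1 - 2 * q * c + q ^ 2 := by
    nlinarith [sq_nonneg (q - c), hc.1, hc.2]
  obtain ⟨θ, rfl⟩ : ∃ θ, Real.cos θ = c := ⟨_, Real.cos_arccos hc.1 hc.2⟩
  refine abs_le_of_sq_le_sq ?_ hW
  rw [T_real_cos, T_real_cos]
  have e : Real.cos (((k : ℤ) : ℝ) * θ) =
      Real.cos ((((k : ℤ) + 1 : ℤ) : ℝ) * θ) * Real.cos θ +
        Real.sin ((((k : ℤ) + 1 : ℤ) : ℝ) * θ) * Real.sin θ := by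
    rw [← Real.cos_sub]; push_cast; ring_nf
  -- With `φ = (k+1)θ` the combination is `a cos φ - b sin φ`, of amplitude `√(a² + b²)`, which is
  -- exactly the right-hand side.
  rw [e]
  set φ := (((k : ℤ) + 1 : ℤ) : ℝ) * θ
  set a := Real.cos θ * (1 + q ^ 2) - 2 * q with ha
  set b := (1 - q ^ 2) * Real.sin θ with hb
  have hab : a ^ 2 + b ^ 2 = (1 - 2 * q * Real.cos θ + q ^ 2) ^ 2 := by
    rw [ha, hb, mul_pow, Real.sin_sq]; ring
  calc _ = (a * Real.cos φ - b * Real.sin φ) ^ 2 := by rw [ha, hb]; ring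
    _ ≤ (a ^ 2 + b ^ 2) * (Real.cos φ ^ 2 + Real.sin φ ^ 2) := by
      nlinarith [sq_nonneg (a * Real.sin φ + b * Real.cos φ)]
    _ = _ := by rw [Real.cos_sq_add_sin_sq, mul_one, hab]

/-- Dividing the last coefficient by `1 - q²` turns the error into a constant times a ratio bounded
by `1`; plain truncation would only give `1 - |q|` in the denominator. -/
theorem abs_poisson_sub_chebyshevApprox_le {q : ℝ} (hq : |q| < 1) {c : ℝ}
    (hc : c ∈ Set.Icc (-1 : ℝ) 1) (k : ℕ) :
    |(1 - q ^ 2) / (1 - 2 * q * c + q ^ 2) - (chebyshevApprox q k).eval c| ≤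
      2 * |q| ^ (k + 2) / (1 - q ^ 2) := by
  obtain ⟨hq1, hq2⟩ := abs_lt.1 hq
  have hq' : 0 < 1 - q ^ 2 := by nlinarith
  have hW : 0 < 1 - 2 * q * c + q ^ 2 := by
    have : |q * c| ≤ |q| := by
      rw [abs_mul]
      exact mul_le_of_le_one_right (abs_nonneg _) (abs_le.2 hc)
    nlinarith [le_abs_self (q * c), sq_abs q, sq_pos_of_pos (sub_pos.2 hq)]
  have hev : (chebyshevApprox q k).eval c =
      (1 + ∑ j ∈ Finset.range k, 2 * q ^ (j + 1) * (T ℝ ((j : ℤ) + 1)).eval c) +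
        2 * q ^ (k + 1) / (1 - q ^ 2) * (T ℝ ((k : ℤ) + 1)).eval c := by
    simp [chebyshevApprox, eval_finsetSum]
  have hS := chebyshev_poisson_partial_sum q c k
  rw [mul_comm, ← eq_div_iff hW.ne'] at hS
  have e : (1 - q ^ 2) / (1 - 2 * q * c + q ^ 2) - (chebyshevApprox q k).eval c =
      2 * q ^ (k + 2) / (1 - q ^ 2) *
        ((2 * (c - q) * (T ℝ ((k : ℤ) + 1)).eval c - (1 - q ^ 2) * (T ℝ (k : ℤ)).eval c) /
          (1 - 2 * q * c + q ^ 2)) := by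
    rw [hev, hS]
    generalize hWdef : 1 - 2 * q * c + q ^ 2 = W at hW
    field_simp
    rw [← hWdef]
    ring
  rw [e, abs_mul, abs_div, abs_div, abs_mul, abs_pow, abs_of_pos hq', abs_of_pos hW, abs_two]
  exact mul_le_of_le_one_right (by positivity)
    ((div_le_one hW).2 (abs_chebyshev_combination_le q hc k))

end Chebyshev

/-- Uniform approximation of the kernel by polynomials of degree `k + 1` in `t`. -/
theorem exists_polynomial_near_loewnerKernel {y : ℝ} (hy : 0 < y) (k : ℕ) :
    ∃ p : ℝ[X], p.natDegree ≤ k + 1 ∧ ∀ s ∈ Set.Icc (0 : ℝ) 1,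
      |loewnerKernel s (y ^ 2) - p.eval s| ≤
        |y - 1 / y| ^ 2 * |(y - 1) / (y + 1)| ^ (k + 1) / 2 := by
  -- This `q` makes `1 - 2q(2s-1) + q²` proportional to the kernel's denominator.
  set q : ℝ := (1 - y) / (1 + y) with hqdef
  have hq : |q| < 1 := by
    rw [hqdef, abs_div, abs_of_pos (by linarith : 0 < 1 + y), div_lt_one (by linarith), abs_lt]
    constructor <;> linarith
  have hq2 : 1 - q ^ 2 = 4 * y / (1 + y) ^ 2 := by rw [hqdef]; field_simp; ring
  have hρ : |(y - 1) / (y + 1)| = |q| := by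
    rw [hqdef, abs_div, abs_div, abs_sub_comm, add_comm]
  have hq' : 0 < 1 - q ^ 2 := by rw [hq2]; positivity
  have hD' : y - 1 / y = -4 * q / (1 - q ^ 2) := by rw [hq2, hqdef]; field_simp; ring
  have hD : |y - 1 / y| = 4 * |q| / (1 - q ^ 2) := by
    rw [hD', abs_div, abs_mul, abs_of_pos hq']; norm_num
  refine ⟨C (y - 1 / y) * (chebyshevApprox q k).comp (C 2 * X - 1), ?_, fun s hs => ?_⟩
  · refine (natDegree_C_mul_le _ _).trans (natDegree_comp_le.trans ?_)
    have h1 : (C (2 : ℝ) * X - 1).natDegree ≤ 1 := by compute_degree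
    calc _ ≤ (k + 1) * 1 := Nat.mul_le_mul (natDegree_chebyshevApprox_le q k) h1
      _ = k + 1 := mul_one _
  · have hc : 2 * s - 1 ∈ Set.Icc (-1 : ℝ) 1 := ⟨by linarith [hs.1], by linarith [hs.2]⟩
    have hW : 1 - 2 * q * (2 * s - 1) + q ^ 2 =
        4 * (s * (y ^ 2 - 1) + 1) / (1 + y) ^ 2 := by
      rw [hqdef]; field_simp; ring
    have hker : loewnerKernel s (y ^ 2) =
        (y - 1 / y) * ((1 - q ^ 2) / (1 - 2 * q * (2 * s - 1) + q ^ 2)) := by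
      have h0 := loewnerKernel_den_pos hs (pow_pos hy 2)
      rw [loewnerKernel, hW, hq2]
      field_simp
    have hev : (C (y - 1 / y) * (chebyshevApprox q k).comp (C 2 * X - 1)).eval s =
        (y - 1 / y) * (chebyshevApprox q k).eval (2 * s - 1) := by
      simp [eval_comp]
    rw [hker, hev, ← mul_sub, abs_mul]
    calc _ ≤ |y - 1 / y| * (2 * |q| ^ (k + 2) / (1 - q ^ 2)) :=
          mul_le_mul_of_nonneg_left (abs_poisson_sub_chebyshevApprox_le hq hc k) (abs_nonneg _)
      -- One factor `|q|/(1 - q²)` is absorbed as `|y - 1/y| / 4`.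
      _ = _ := by
        rw [hρ, hD]
        field_simp
        ring

/-! ### Uniqueness of the representing measure. -/

section Moments

theorem integrable_of_continuousOn_Icc {μ : Measure ℝ} [IsFiniteMeasure μ]
    (hμ : ∀ᵐ s ∂μ, s ∈ Set.Icc (0 : ℝ) 1) {f : ℝ → ℝ} (hf : ContinuousOn f (Set.Icc 0 1)) :
    Integrable f μ := by
  have := hf.integrableOn_compact (μ := μ) isCompact_Icc
  rwa [IntegrableOn, Measure.restrict_eq_self_of_ae_mem hμ] at this

/-- Finite measures carried by `[0,1]` with the same polynomial integrals are equal. -/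
theorem ext_of_integral_pow_eq {μ ν : Measure ℝ} [IsFiniteMeasure μ] [IsFiniteMeasure ν]
    (hμ : ∀ᵐ s ∂μ, s ∈ Set.Icc (0 : ℝ) 1) (hν : ∀ᵐ s ∂ν, s ∈ Set.Icc (0 : ℝ) 1)
    (h : ∀ n : ℕ, ∫ s, s ^ n ∂μ = ∫ s, s ^ n ∂ν) : μ = ν := by
  have hpoly : ∀ p : ℝ[X], ∫ s, p.eval s ∂μ = ∫ s, p.eval s ∂ν := by
    intro p
    simp only [eval_eq_sum_range]
    rw [integral_finsetSum _ fun i _ => integrable_of_continuousOn_Icc hμ (by fun_prop),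
      integral_finsetSum _ fun i _ => integrable_of_continuousOn_Icc hν (by fun_prop)]
    simp only [integral_const_mul, h]
  refine ext_of_forall_integral_eq_of_IsFiniteMeasure fun f => ?_
  have hbound : ∀ (ξ : Measure ℝ) [IsFiniteMeasure ξ], (∀ᵐ s ∂ξ, s ∈ Set.Icc (0 : ℝ) 1) →
      ∀ (p : ℝ[X]) (ε : ℝ), (∀ s ∈ Set.Icc (0 : ℝ) 1, |p.eval s - f s| < ε) →
        |∫ s, p.eval s ∂ξ - ∫ s, f s ∂ξ| ≤ ε * ξ.real Set.univ := by
    intro ξ _ hξ p ε hp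
    rw [← integral_sub (integrable_of_continuousOn_Icc hξ p.continuous.continuousOn)
      (integrable_of_continuousOn_Icc hξ f.continuous.continuousOn)]
    exact norm_integral_le_of_norm_le_const
      (hξ.mono fun s hs => (Real.norm_eq_abs _).trans_le (hp s hs).le)
  set M : ℝ := μ.real Set.univ + ν.real Set.univ with hM
  have hM0 : 0 ≤ M := by positivity
  refine eq_of_abs_sub_le_all fun ε hε => ?_
  obtain ⟨p, hp⟩ := exists_polynomial_near_of_continuousOn 0 1 f f.continuous.continuousOn
    (ε / (M + 1)) (by positivity)
  have h1 := hbound μ hμ p _ hp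
  have h2 := hbound ν hν p _ hp
  rw [hpoly p] at h1
  have h3 : ε / (M + 1) * M ≤ ε := by
    rw [div_mul_eq_mul_div, div_le_iff₀ (by positivity)]
    nlinarith
  rw [hM, mul_add] at h3
  rw [abs_le] at *
  constructor <;> linarith [h1.1, h1.2, h2.1, h2.2]

theorem continuousAt_integral_pow_div {μ : Measure ℝ} [IsFiniteMeasure μ]
    (hμ : ∀ᵐ s ∂μ, s ∈ Set.Icc (0 : ℝ) 1) (n : ℕ) :
    ContinuousAt (fun x => ∫ s, s ^ n / (s * (x - 1) + 1) ∂μ) 1 := by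
  have hx : ∀ᶠ x : ℝ in nhds 1, 1 / 2 < x := eventually_gt_nhds (by norm_num)
  refine continuousAt_of_dominated (bound := fun _ => 2) ?_ ?_ (integrable_const _) ?_
  · exact Filter.Eventually.of_forall fun x => Measurable.aestronglyMeasurable (by fun_prop)
  · filter_upwards [hx] with x hx
    filter_upwards [hμ] with s hs
    have h0 : 1 / 2 ≤ s * (x - 1) + 1 := by nlinarith [hs.1, hs.2]
    have h1 : s ^ n ≤ 1 := pow_le_one₀ hs.1 hs.2
    rw [Real.norm_eq_abs, abs_of_nonneg (div_nonneg (pow_nonneg hs.1 n) (by linarith)),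
      div_le_iff₀ (by linarith)]
    linarith
  · refine Filter.Eventually.of_forall fun s => ?_
    exact ContinuousAt.div (by fun_prop) (by fun_prop) (by simp)

/-- The kernel transform determines a finite measure on `[0,1]`. -/
theorem ext_of_integral_loewnerKernel_eq {μ ν : Measure ℝ} [IsFiniteMeasure μ]
    [IsFiniteMeasure ν]
    (hμ : ∀ᵐ s ∂μ, s ∈ Set.Icc (0 : ℝ) 1) (hν : ∀ᵐ s ∂ν, s ∈ Set.Icc (0 : ℝ) 1)
    (h : ∀ x : ℝ, 0 < x → ∫ s, loewnerKernel s x ∂μ = ∫ s, loewnerKernel s x ∂ν) : μ = ν := by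
  -- The `n`-th moment is the limit as `x → 1`.
  have ext_one : ∀ n : ℕ, (∀ x : ℝ, 0 < x → x ≠ 1 →
      ∫ s, s ^ n / (s * (x - 1) + 1) ∂μ = ∫ s, s ^ n / (s * (x - 1) + 1) ∂ν) →
      ∫ s, s ^ n ∂μ = ∫ s, s ^ n ∂ν := by
    intro n hn
    have h1 := (continuousAt_integral_pow_div hμ n).tendsto.mono_left
      (nhdsWithin_le_nhds (s := {1}ᶜ))
    have h2 := (continuousAt_integral_pow_div hν n).tendsto.mono_left
      (nhdsWithin_le_nhds (s := {1}ᶜ))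
    have h3 : (fun x => ∫ s, s ^ n / (s * (x - 1) + 1) ∂μ) =ᶠ[nhdsWithin 1 {1}ᶜ]
        fun x => ∫ s, s ^ n / (s * (x - 1) + 1) ∂ν := by
      filter_upwards [self_mem_nhdsWithin,
        nhdsWithin_le_nhds (eventually_gt_nhds (zero_lt_one' ℝ))] with x hx1 hx0
      exact hn x hx0 hx1
    simpa using tendsto_nhds_unique (h1.congr' h3) h2
  have key : ∀ n : ℕ, ∀ x : ℝ, 0 < x → x ≠ 1 →
      ∫ s, s ^ n / (s * (x - 1) + 1) ∂μ = ∫ s, s ^ n / (s * (x - 1) + 1) ∂ν := by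
    intro n
    induction n with
    | zero =>
      intro x hx hx1
      have hz : x - 1 ≠ 0 := sub_ne_zero.2 hx1
      have := h x hx
      simp only [loewnerKernel, div_eq_mul_inv, integral_const_mul] at this
      simpa using mul_left_cancel₀ hz this
    | succ n ih =>
      intro x hx hx1
      have hz : x - 1 ≠ 0 := sub_ne_zero.2 hx1
      -- From `s(x-1) = (s(x-1)+1) - 1`: the `n`-th moment and transform give the next transform.
      have step : ∀ (ξ : Measure ℝ) [IsFiniteMeasure ξ], (∀ᵐ s ∂ξ, s ∈ Set.Icc (0 : ℝ) 1) →
          ∫ s, s ^ (n + 1) / (s * (x - 1) + 1) ∂ξ =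
            (x - 1)⁻¹ * (∫ s, s ^ n ∂ξ - ∫ s, s ^ n / (s * (x - 1) + 1) ∂ξ) := by
        intro ξ _ hξ
        have hi : Integrable (fun s : ℝ => s ^ n / (s * (x - 1) + 1)) ξ :=
          integrable_of_continuousOn_Icc hξ (ContinuousOn.div (by fun_prop) (by fun_prop)
            fun s hs => (loewnerKernel_den_pos hs hx).ne')
        rw [← integral_sub (integrable_of_continuousOn_Icc hξ (by fun_prop)) hi,
          ← integral_const_mul]
        refine integral_congr_ae (hξ.mono fun s hs => ?_)
        have h0 := (loewnerKernel_den_pos hs hx).ne'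
        simp only
        field_simp
        ring
      rw [step μ hμ, step ν hν, ih x hx hx1, ext_one n ih]
  exact ext_of_integral_pow_eq hμ hν fun n => ext_one n (key n)

end Moments

/-- Reflecting `ν` turns its transform `F(x)` into `-F(1/x)`, and transforms determine measures. -/
theorem map_one_sub_eq_iff {ν : Measure ℝ} [IsFiniteMeasure ν]
    (hν : ∀ᵐ s ∂ν, s ∈ Set.Icc (0 : ℝ) 1) :
    ν.map (fun s => 1 - s) = ν ↔
      ∀ x : ℝ, 0 < x → ∫ s, loewnerKernel s x⁻¹ ∂ν = -∫ s, loewnerKernel s x ∂ν := by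
  have hmeas : Measurable fun s : ℝ => 1 - s := by fun_prop
  have hmap : ∀ x : ℝ, 0 < x →
      ∫ s, loewnerKernel s x ∂(ν.map fun s => 1 - s) = -∫ s, loewnerKernel s x⁻¹ ∂ν := by
    intro x hx
    have hk : Measurable fun s => loewnerKernel s x := by unfold loewnerKernel; fun_prop
    rw [integral_map hmeas.aemeasurable hk.aestronglyMeasurable, ← integral_neg]
    refine integral_congr_ae (hν.mono fun s hs => ?_)
    simp only
    rw [loewnerKernel_inv hs hx, neg_neg]
  constructor
  · intro h x hx
    have := hmap x hx
    rw [h] at this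
    linarith
  · intro h
    refine ext_of_integral_loewnerKernel_eq ?_ hν fun x hx => ?_
    · refine (ae_map_iff hmeas.aemeasurable measurableSet_Icc).2 ?_
      exact hν.mono fun s hs => ⟨by linarith [hs.2], by linarith [hs.1]⟩
    · rw [hmap x hx, h x hx, neg_neg]

/-! ### Final estimates. -/

theorem IsGaussianQuadrature.abs_error_loewnerKernel_le {ν : Measure ℝ}
    [IsProbabilityMeasure ν] (hν : ν (Set.Icc (0 : ℝ) 1) = 1) {m : ℕ} {t w : Fin m → ℝ}
    (hq : IsGaussianQuadrature ν m t w) (hm : 1 ≤ m) {x : ℝ} (hx : 0 < x) :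
    |∫ s in Set.Icc (0 : ℝ) 1, loewnerKernel s x ∂ν - ∑ i, w i * loewnerKernel (t i) x| ≤
      |√x - 1 / √x| ^ 2 * |(√x - 1) / (√x + 1)| ^ (2 * m - 1) := by
  -- Degree `k + 1 = 2m - 1` is the largest integrated exactly.
  obtain ⟨p, hp, hps⟩ := exists_polynomial_near_loewnerKernel (Real.sqrt_pos.2 hx) (2 * m - 2)
  rw [Real.sq_sqrt hx.le, show 2 * m - 2 + 1 = 2 * m - 1 by omega] at hps
  have := hq.abs_error_le hm (continuousOn_loewnerKernel hx) (by omega) hps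
  rw [measureReal_def, hν] at this
  refine this.trans (le_of_eq ?_)
  simp
  ring

/-- One factor is traded via `|y - 1/y| (1 - ρ²) = 4ρ` and `1 - ρ ≤ 1 - ρ²`. -/
theorem sq_mul_pow_le {y : ℝ} (hy : 0 < y) {m : ℕ} (hm : 1 ≤ m) :
    |y - 1 / y| ^ 2 * |(y - 1) / (y + 1)| ^ (2 * m - 1) ≤
      4 * |y - 1 / y| *
        (|(y - 1) / (y + 1)| ^ (2 * m) / (1 - |(y - 1) / (y + 1)|)) := by
  set ρ : ℝ := |(y - 1) / (y + 1)| with hρ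
  have hρ0 : 0 ≤ ρ := abs_nonneg _
  have hρ1 : ρ < 1 := by
    rw [hρ, abs_div, abs_of_pos (by linarith : 0 < y + 1), div_lt_one (by linarith), abs_lt]
    constructor <;> linarith
  have hD : |y - 1 / y| * (1 - ρ ^ 2) = 4 * ρ := by
    have h1 : 1 - ρ ^ 2 = 4 * y / (y + 1) ^ 2 := by
      rw [hρ, sq_abs]; field_simp; ring
    have h2 : y - 1 / y = (y - 1) / (y + 1) * ((y + 1) ^ 2 / y) := by field_simp; ring
    rw [h1, h2, abs_mul, ← hρ, abs_of_pos (by positivity : 0 < (y + 1) ^ 2 / y)]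
    field_simp
  have hD' : |y - 1 / y| * (1 - ρ) ≤ 4 * ρ := by
    rw [← hD]
    exact mul_le_mul_of_nonneg_left (by nlinarith) (abs_nonneg _)
  obtain ⟨n, rfl⟩ : ∃ n, m = n + 1 := ⟨m - 1, by omega⟩
  rw [show 2 * (n + 1) - 1 = 2 * n + 1 by omega, show 2 * (n + 1) = 2 * n + 1 + 1 by omega,
    ← mul_div_assoc, le_div_iff₀ (by linarith)]
  calc _ = |y - 1 / y| * ρ ^ (2 * n + 1) * (|y - 1 / y| * (1 - ρ)) := by ring
    _ ≤ |y - 1 / y| * ρ ^ (2 * n + 1) * (4 * ρ) :=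
      mul_le_mul_of_nonneg_left hD' (by positivity)
    _ = _ := by ring

theorem propositionB2 (g : ℝ → ℝ) (ν : Measure ℝ) [IsProbabilityMeasure ν]
    (hν : ν (Set.Icc (0 : ℝ) 1) = 1) (hg : HasLoewnerRep g ν) (hg' : 0 ≤ deriv g 1)
    (m : ℕ) (t w : Fin m → ℝ) (hq : IsGaussianQuadrature ν m t w) :
    (1 ≤ m → ∀ x : ℝ, 0 < x →
      |g x - quadratureApprox g t w x| ≤
        4 * deriv g 1 * |√x - 1 / √x| *
          (|(√x - 1) / (√x + 1)| ^ (2 * m) / (1 - |(√x - 1) / (√x + 1)|))) ∧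
    (ν.map (fun s => 1 - s) = ν → 1 ≤ m → ∀ x : ℝ, 0 < x →
      |g x - quadratureApprox g t w x| ≤
        deriv g 1 * |√x - 1 / √x| ^ 2 * |(√x - 1) / (√x + 1)| ^ (2 * m - 1)) ∧
    (deriv g 1 ≠ 0 →
      (ν.map (fun s => 1 - s) = ν ↔ ∀ x : ℝ, 0 < x → g x⁻¹ - g 1 = -(g x - g 1))) ∧
    (∀ x : ℝ, 0 < x → x ≤ 1 → g x ≤ quadratureApprox g t w x) ∧
    (∀ x : ℝ, 1 ≤ x → quadratureApprox g t w x ≤ g x) := by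
  have hae : ∀ᵐ s ∂ν, s ∈ Set.Icc (0 : ℝ) 1 :=
    (mem_ae_iff_prob_eq_one measurableSet_Icc).2 hν
  have herr : ∀ x : ℝ, 0 < x → g x - quadratureApprox g t w x = deriv g 1 *
      (∫ s in Set.Icc (0 : ℝ) 1, loewnerKernel s x ∂ν -
        ∑ i, w i * loewnerKernel (t i) x) := fun x hx => by
    rw [quadratureApprox, hg.eq_integral x hx]
    ring
  have hbound : 1 ≤ m → ∀ x : ℝ, 0 < x → |g x - quadratureApprox g t w x| ≤
      deriv g 1 * (|√x - 1 / √x| ^ 2 * |(√x - 1) / (√x + 1)| ^ (2 * m - 1)) := by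
    intro hm x hx
    rw [herr x hx, abs_mul, abs_of_nonneg hg']
    exact mul_le_mul_of_nonneg_left (hq.abs_error_loewnerKernel_le hν hm hx) hg'
  refine ⟨fun hm x hx => ?_, fun _ hm x hx => ?_, fun hg0 => ?_, fun x hx hx1 => ?_,
    fun x hx1 => ?_⟩
  · refine (hbound hm x hx).trans ?_
    refine (mul_le_mul_of_nonneg_left (sq_mul_pow_le (Real.sqrt_pos.2 hx) hm) hg').trans
      (le_of_eq ?_)
    ring
  · rw [mul_assoc]
    exact hbound hm x hx
  · rw [map_one_sub_eq_iff hae]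
    refine forall₂_congr fun x hx => ?_
    rw [hg.eq_integral x hx, hg.eq_integral x⁻¹ (inv_pos.2 hx),
      Measure.restrict_eq_self_of_ae_mem hae, add_sub_cancel_left, add_sub_cancel_left,
      ← mul_neg, mul_right_inj' hg0]
  · obtain ⟨c, hc, e⟩ := hq.exists_error_eq hx
    have := herr x hx
    rw [e] at this
    nlinarith [mul_nonneg hg' (mul_nonneg (sub_nonneg.2 hx1) hc)]
  · have hx : 0 < x := by linarith
    obtain ⟨c, hc, e⟩ := hq.exists_error_eq hx
    have := herr x hx
    rw [e] at this
    nlinarith [mul_nonneg hg' (mul_nonneg (sub_nonneg.2 hx1) hc)]
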